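/- Let $\mathbf{k}$ be a commutative ring and let $n\ge 0$ be an integer. For an integer $m$ write $[m]=\{1,2,\dots,m\}$ (empty if $m\le 0$). Let $S_n$ be the group of permutations of $[n]$, with $(\pi\sigma)(j)=\pi(\sigma(j))$, and let $s_j\in S_n$ (for $j\in[n-1]$) be the transposition swapping $j$ and $j+1$. For $w\in S_n$ let $\operatorname{Des}w=\{j\in[n-1] : w(j)>w(j+1)\}$. For $I\subseteq[n-1]$ put $$I'=\{j\in[n-1] : j\notin I,\ j+1\notin I\},\qquad F(I)=\{q\in\mathbf{k}[S_n] : q s_j=q\text{ for all }j\in I'\}.$$ A set of integers is called lacunar if it contains no two consecutive integers. Let $f_0=0$, $f_1=1$, $f_m=f_{m-1}+f_{m-2}$ be the Fibonacci numbers; there are exactly $f_{n+1}$ lacunar subsets of $[n-1]$. Let $Q_1,Q_2,\dots,Q_{f_{n+1}}$ be all of them (without repetition), listed in any order in which the sums of their elements are weakly increasing. Set $F_i=F(Q_1)+F(Q_2)+\cdots+F(Q_i)$ for $0\le i\le f_{n+1}$, so that $0=F_0\subseteq F_1\subseteq\cdots\subseteq F_{f_{n+1}}$. For $w\in S_n$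 let $\operatorname{Qind}w$ (the $Q$-index of $w$) be the smallest $i\in[f_{n+1}]$ such that $Q_i'\subseteq\operatorname{Des}w$. **Theorem.** Let $i\in[f_{n+1}]$, and let $\delta_i$ be the number of all permutations $w\in S_n$ with $\operatorname{Qind}w=i$. Then: (a) The $\mathbf{k}$-module $F_i/F_{i-1}$ is free of rank $\delta_i$ (that is, it has a basis of size $\delta_i$). (b) The number $\delta_i$ equals the number of all $w\in S_n$ that satisfy $w(j)<w(j+1)$ for all $j\in Q_i$ and $w(j)>w(j+1)$ for all $j\in Q_i'$. (c) Write $Q_i=\{i_1<i_2<\cdots<i_p\}$, set $i_0=1$ and $i_{p+1}=n+1$, and let $j_m=i_m-i_{m-1}$ for each $m\in[p+1]$. Then $j_1+j_2+\cdots+j_{p+1}=n$ and $$\delta_i=\binom{n}{j_1,j_2,\dots,j_{p+1}}\cdot\prod_{m=2}^{p+1}(j_m-1),\qquad\text{where }\binom{n}{j_1,j_2,\dots,j_{p+1}}=\frac{n!}{j_1!\,j_2!\cdots j_{p+1}!}.$$ (d) We have $\delta_i\mid n!$. -/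

import Mathlib

open scoped Nat

namespace CycleShuffle

/-- The set `[n] = {1, 2, …, n}` of positive integers. -/
abbrev interval (n : ℕ) : Finset ℕ := Finset.Icc 1 n

/-- The symmetric group `S_n` of all permutations of `[n]`, multiplied by
`(π * σ) i = π (σ i)`. -/
abbrev Sym (n : ℕ) : Type := Equiv.Perm (interval n)

/-- The value `w(j)` as a natural number, for `j ∈ [n]`.
(For `j ∉ [n]` the value is `j`; it is never used.) -/
def value {n : ℕ} (w : Sym n) (j : ℕ) : ℕ :=
  if h : j ∈ interval n then (w ⟨j, h⟩ : ℕ) else j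

/-- The simple transposition `s_i ∈ S_n`, which swaps `i` and `i + 1`, for `i ∈ [n - 1]`.
(For other `i` it is the identity; this is never used.) -/
def simpleTransposition (n i : ℕ) : Sym n :=
  if h : i ∈ interval n ∧ i + 1 ∈ interval n then
    Equiv.swap ⟨i, h.1⟩ ⟨i + 1, h.2⟩
  else 1

/-- The descent set of `w`: all `i ∈ [n - 1]` such that `w(i) > w(i + 1)`. -/
def descentSet {n : ℕ} (w : Sym n) : Finset ℕ :=
  (interval (n - 1)).filter fun i => value w (i + 1) < value w i

/-- A set of integers is lacunar if it contains no two consecutive integers. -/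
def IsLacunar (I : Finset ℕ) : Prop := ∀ i ∈ I, i + 1 ∉ I

/-- The non-shadow `I'` of `I`: all `i ∈ [n - 1]` such that `i ∉ I` and `i + 1 ∉ I`. -/
def nonShadow (n : ℕ) (I : Finset ℕ) : Finset ℕ :=
  (interval (n - 1)).filter fun i => i ∉ I ∧ i + 1 ∉ I

/-- `Q 1, Q 2, …, Q f_{n+1}` (with `f` the Fibonacci sequence) is a listing, without
repetition, of all the lacunar subsets of `[n - 1]`, in an order in which the sum of the
elements is weakly increasing. The values of `Q` at other arguments play no role. -/
structure IsLacunarListing (n : ℕ) (Q : ℕ → Finset ℕ) : Prop where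
  bijOn : Set.BijOn Q (Set.Icc 1 (Nat.fib (n + 1)))
    {I : Finset ℕ | I ⊆ interval (n - 1) ∧ IsLacunar I}
  sum_mono : MonotoneOn (fun i => ∑ x ∈ Q i, x) (Set.Icc 1 (Nat.fib (n + 1)))

/-- The invariant space `F(I) = {q ∈ k[S_n] | q s_i = q for all i ∈ I'}`. -/
noncomputable def invariantSpace (k : Type*) [CommRing k] (n : ℕ) (I : Finset ℕ) :
    Submodule k (MonoidAlgebra k (Sym n)) where
  carrier := {q | ∀ i ∈ nonShadow n I,
    q * MonoidAlgebra.of k (Sym n) (simpleTransposition n i) = q}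
  add_mem' := fun ha hb i hi => by rw [add_mul, ha i hi, hb i hi]
  zero_mem' := fun i _ => zero_mul _
  smul_mem' := fun c a ha i hi => by rw [smul_mul_assoc, ha i hi]

/-- The member `F_i = F(Q_1) + F(Q_2) + ⋯ + F(Q_i)` of the Fibonacci filtration. -/
noncomputable def filtration (k : Type*) [CommRing k] (n : ℕ) (Q : ℕ → Finset ℕ) (i : ℕ) :
    Submodule k (MonoidAlgebra k (Sym n)) :=
  ⨆ m ∈ Finset.Icc 1 i, invariantSpace k n (Q m)

theorem filtration_mono (k : Type*) [CommRing k] (n : ℕ) (Q : ℕ → Finset ℕ) :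
    Monotone (filtration k n Q) := fun _ _ h =>
  biSup_mono fun _ hm =>
    Finset.mem_Icc.2 ⟨(Finset.mem_Icc.1 hm).1, (Finset.mem_Icc.1 hm).2.trans h⟩

/-- The subquotient `F_i / F_{i-1}` (for `i ≥ 1`): the quotient of `F_i` by `F_{i-1}`,
the latter being regarded as a submodule of `F_i`. -/
abbrev Subquotient (k : Type*) [CommRing k] (n : ℕ) (Q : ℕ → Finset ℕ) (i : ℕ) : Type _ :=
  filtration k n Q i ⧸ (filtration k n Q (i - 1)).submoduleOf (filtration k n Q i)

/-- The `Q`-index of `w`: the smallest `i ∈ [f_{n+1}]` such that `Q_i' ⊆ Des w`. -/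
noncomputable def qIndex {n : ℕ} (Q : ℕ → Finset ℕ) (w : Sym n) : ℕ :=
  sInf {i : ℕ | i ∈ interval (Nat.fib (n + 1)) ∧ nonShadow n (Q i) ⊆ descentSet w}

/-- The number `δ_i` of all permutations `w ∈ S_n` whose `Q`-index is `i`. -/
noncomputable def delta (n : ℕ) (Q : ℕ → Finset ℕ) (i : ℕ) : ℕ :=
  Nat.card {w : Sym n // qIndex Q w = i}

end CycleShuffle

open CycleShuffle

/-! For each `w`, let `cosetSum k w` be the sum of the coset of `w` under the Young subgroup of its
descent runs. As `w` decreases on each run, it is the lexicographically largest element of its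
coset, so these sums are unitriangular against the standard basis. A leading-term argument then
shows that `F(I)` is spanned by the sums with `I' ⊆ Des w` (`invariantSpace_eq_span`). Hence every
`F_i` is spanned by a subset of one fixed basis, and `F_i / F_{i-1}` has a basis indexed by the `w`
with `Qind w = i`.

For (b), every `w` has some lacunar set `I` of ascents whose non-shadow `I'` consists of descents.
Any other lacunar `K` with `K' ⊆ Des w` has a larger sum (`HasPattern.eq_or_sum_lt`), so `I` comes
first in the listing.

For (c), the elements of `I` cut `[n]` into blocks, and the conditions on `w` concern each block
separately: the first block decreases, and every later one ascends once and then decreases. A block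
of length `r` has 1, respectively `r - 1`, such orders, and the blocks are independent. Part (d)
follows since `j - 1` divides `j!` for `j ≥ 2`. -/

namespace CycleShuffle

/-! ### Unitriangular families and leading terms -/

section Unitriangular

variable {k G α : Type*} [CommRing k] [Fintype G] [LinearOrder α]

/-- Gaussian elimination: the leading index of `q` lies in `S`, so a multiple of the matching `b w ∈
F` cancels its leading term. No division occurs because the diagonal coefficients are 1. -/
theorem eq_span_of_leadingTerm {κ : G → α} (hκ : Function.Injective κ)
    {b : G → MonoidAlgebra k G} (hdiag : ∀ w, (b w).coeff w = 1)
    (hlt : ∀ w u, (b w).coeff u ≠ 0 → κ u ≤ κ w)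
    {S : Set G} {F : Submodule k (MonoidAlgebra k G)} (hbF : ∀ w ∈ S, b w ∈ F)
    (hlead : ∀ q ∈ F, ∀ w, q.coeff w ≠ 0 → (∀ u, q.coeff u ≠ 0 → κ u ≤ κ w) → w ∈ S) :
    F = Submodule.span k (b '' S) := by
  classical
  apply le_antisymm
  -- `A` is closed downwards under `κ`, so subtracting a multiple of `b a` with `a ∈ A` keeps the
  -- support inside `A`.
  · have key : ∀ A : Finset G, (∀ x ∈ A, ∀ y, κ y ≤ κ x → y ∈ A) →
        ∀ q ∈ F, (∀ u, q.coeff u ≠ 0 → u ∈ A) → q ∈ Submodule.span k (b '' S) := by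
      intro A
      induction A using Finset.induction_on_max_value κ with
      | empty =>
        intro _ q _ hq
        have : q = 0 := by
          ext u
          by_contra h
          simpa using hq u h
        rw [this]
        exact zero_mem _
      | insert a s has hmax ih =>
        intro hlow q hqF hq
        have hlow' : ∀ x ∈ s, ∀ y, κ y ≤ κ x → y ∈ s := by
          intro x hx y hy
          rcases Finset.mem_insert.1 (hlow x (Finset.mem_insert_of_mem hx) y hy) with rfl | h
          · have := hκ (le_antisymm hy (hmax x hx))
            exact this ▸ hx
          · exact h
        by_cases hqa : q.coeff a = 0
        · refine ih hlow' q hqF fun u hu => ?_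
          rcases Finset.mem_insert.1 (hq u hu) with rfl | h
          · exact absurd hqa hu
          · exact h
        · have haS : a ∈ S := by
            refine hlead q hqF a hqa fun u hu => ?_
            rcases Finset.mem_insert.1 (hq u hu) with rfl | h
            · exact le_rfl
            · exact hmax u h
          have hr : q - q.coeff a • b a ∈ Submodule.span k (b '' S) := by
            refine ih hlow' _ (sub_mem hqF (F.smul_mem _ (hbF a haS))) fun u hu => ?_
            have hu' : q.coeff u - q.coeff a * (b a).coeff u ≠ 0 := by simpa using hu
            have hua : u ≠ a := by
              rintro rfl
              simp [hdiag] at hu'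
            have : u ∈ insert a s := by
              by_cases h : q.coeff u = 0
              · refine hlow a (Finset.mem_insert_self _ _) u (hlt a u fun h' => hu' ?_)
                simp [h, h']
              · exact hq u h
            exact (Finset.mem_insert.1 this).resolve_left hua
          have := add_mem hr (Submodule.smul_mem _ (q.coeff a)
            (Submodule.subset_span (Set.mem_image_of_mem b haS)))
          simpa using this
    intro q hq
    exact key Finset.univ (by simp) q hq (by simp)
  · rw [Submodule.span_le]
    rintro _ ⟨w, hw, rfl⟩
    exact hbF w hw

theorem linearIndependent_of_unitriangular {κ : G → α} (hκ : Function.Injective κ)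
    {b : G → MonoidAlgebra k G} (hdiag : ∀ w, (b w).coeff w = 1)
    (hlt : ∀ w u, (b w).coeff u ≠ 0 → κ u ≤ κ w) : LinearIndependent k b := by
  classical
  rw [Fintype.linearIndependent_iff]
  intro c hc
  by_contra! hne
  obtain ⟨w₀, hw₀⟩ := hne
  obtain ⟨w, hw, hmax⟩ := (Finset.univ.filter fun w => c w ≠ 0).exists_max_image κ
    ⟨w₀, by simpa using hw₀⟩
  have h := congrArg (fun q => q.coeff w) hc
  simp only [MonoidAlgebra.coeff_sum, MonoidAlgebra.coeff_smul, MonoidAlgebra.coeff_zero,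
    Finsupp.coe_finsetSum, Finset.sum_apply, Finsupp.coe_smul, Pi.smul_apply, smul_eq_mul,
    Finsupp.coe_zero, Pi.zero_apply] at h
  rw [Finset.sum_eq_single w, hdiag, mul_one] at h
  · exact (Finset.mem_filter.1 hw).2 h
  · intro v _ hv
    by_contra hvw
    have h1 : c v ≠ 0 := left_ne_zero_of_mul hvw
    have h2 := hlt v w (right_ne_zero_of_mul hvw)
    exact hv (hκ (le_antisymm (hmax v (by simpa using h1)) h2))
  · simp

end Unitriangular

/-- If `b` is a basis, the quotient of the span of `b '' S` by the span of `b '' T` has a basis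
indexed by `S \ T`. -/
noncomputable def quotientSpanBasis {k M ι : Type*} [CommRing k] [AddCommGroup M] [Module k M]
    (b : Module.Basis ι k M) {S T : Set ι} {A B : Submodule k M}
    (hA : A = Submodule.span k (b '' S)) (hB : B = Submodule.span k (b '' T)) :
    Module.Basis ↥(S \ T) k (A ⧸ B.submoduleOf A) :=
  -- Restricting coordinates to `S \ T` has kernel `B` on `A`: elements of `A` have support in `S`,
  -- so vanishing there means support in `T`. This does not need `T ⊆ S`.
  let res : A →ₗ[k] (↥(S \ T) →₀ k) :=
    (Finsupp.lsubtypeDomain (S \ T)) ∘ₗ b.repr.toLinearMap ∘ₗ A.subtype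
  have hres : ∀ (x : A) (w : ↥(S \ T)), res x w = b.repr x w := fun _ _ => rfl
  have hker : LinearMap.ker res = B.submoduleOf A := by
    ext x
    have hx : ↑(b.repr x).support ⊆ S := b.mem_span_image.1 (hA ▸ x.2)
    rw [LinearMap.mem_ker, Submodule.submoduleOf, Submodule.mem_comap, hB,
      Submodule.subtype_apply, b.mem_span_image]
    constructor
    · intro h w hw
      by_contra hwT
      have := hres x ⟨w, hx hw, hwT⟩
      rw [h] at this
      exact (Finsupp.mem_support_iff.1 hw) this.symm
    · intro h
      ext w
      rw [hres]
      by_contra hw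
      exact w.2.2 (h (Finsupp.mem_support_iff.2 hw))
  have hsurj : Function.Surjective res := by
    intro c
    have hmem : b.repr.symm (c.mapDomain Subtype.val) ∈ A := by
      rw [hA, b.mem_span_image, LinearEquiv.apply_symm_apply]
      classical
      intro w hw
      obtain ⟨v, _, rfl⟩ := Finset.mem_image.1 (Finsupp.mapDomain_support hw)
      exact v.2.1
    refine ⟨⟨_, hmem⟩, ?_⟩
    ext w
    rw [hres, LinearEquiv.apply_symm_apply, Finsupp.mapDomain_apply Subtype.val_injective]
  .ofRepr ((Submodule.quotEquivOfEq _ _ hker.symm).trans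
    (res.quotKerEquivOfSurjective hsurj))

/-! ### Descent runs and their Young subgroups -/

/-- The number of non-elements of `D` below `x`. It is constant exactly on the maximal runs of
positions linked by elements of `D`. -/
def blockLabel (D : Finset ℕ) (x : ℕ) : ℕ := ((Finset.range x).filter (· ∉ D)).card

theorem blockLabel_mono (D : Finset ℕ) : Monotone (blockLabel D) := fun _ _ h =>
  Finset.card_le_card (Finset.filter_subset_filter _ (Finset.range_mono h))

theorem blockLabel_succ_eq_iff {D : Finset ℕ} {x : ℕ} :
    blockLabel D (x + 1) = blockLabel D x ↔ x ∈ D := by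
  unfold blockLabel
  rw [Finset.range_add_one, Finset.filter_insert]
  by_cases h : x ∈ D <;> simp [h]

/-- The Young subgroup of all permutations that preserve the maximal runs linked by `D`. -/
def blockGroup (n : ℕ) (D : Finset ℕ) : Subgroup (Sym n) where
  carrier := {σ | ∀ x, blockLabel D (σ x) = blockLabel D x}
  mul_mem' := fun {σ τ} hσ hτ x => (hσ (τ x)).trans (hτ x)
  one_mem' := fun _ => rfl
  inv_mem' := fun {σ} hσ x => by simpa using (hσ (σ⁻¹ x)).symm

theorem value_of_mem {n : ℕ} (w : Sym n) {j : ℕ} (hj : j ∈ interval n) :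
    value w j = w ⟨j, hj⟩ := dif_pos hj

theorem value_coe {n : ℕ} (w : Sym n) (x : interval n) : value w x = w x :=
  value_of_mem w x.2

theorem mem_descentSet {n : ℕ} {w : Sym n} {j : ℕ} :
    j ∈ descentSet w ↔ (1 ≤ j ∧ j ≤ n - 1) ∧ value w (j + 1) < value w j := by
  simp [descentSet]

theorem mem_nonShadow {n : ℕ} {I : Finset ℕ} {j : ℕ} :
    j ∈ nonShadow n I ↔ (1 ≤ j ∧ j ≤ n - 1) ∧ j ∉ I ∧ j + 1 ∉ I := by
  simp [nonShadow]

theorem value_ne_value_succ {n : ℕ} (w : Sym n) {j : ℕ} (h1 : 1 ≤ j) (h2 : j ≤ n - 1) :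
    value w j ≠ value w (j + 1) := by
  have hj : j ∈ interval n := Finset.mem_Icc.2 (by omega)
  have hj' : j + 1 ∈ interval n := Finset.mem_Icc.2 (by omega)
  rw [value_of_mem w hj, value_of_mem w hj']
  intro h
  have := congrArg Subtype.val (w.injective (Subtype.ext h))
  simp at this

/-- Equal labels make every position from `x` to `y - 1` a descent. -/
theorem value_lt_of_blockLabel_eq {n : ℕ} {w : Sym n} {x y : ℕ} (hxy : x < y)
    (h : blockLabel (descentSet w) x = blockLabel (descentSet w) y) : value w y < value w x := by
  induction y, hxy using Nat.le_induction with
  | base => exact (mem_descentSet.1 (blockLabel_succ_eq_iff.1 h.symm)).2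
  | succ y hy ih =>
    have h1 : blockLabel (descentSet w) x = blockLabel (descentSet w) y :=
      le_antisymm (blockLabel_mono _ (by omega)) (h ▸ blockLabel_mono _ (by omega))
    exact (mem_descentSet.1 (blockLabel_succ_eq_iff.1 (h.symm.trans h1))).2.trans (ih h1)

theorem simpleTransposition_eq {n j : ℕ} (h1 : 1 ≤ j) (h2 : j ≤ n - 1) :
    simpleTransposition n j = Equiv.swap ⟨j, Finset.mem_Icc.2 (by omega)⟩
      ⟨j + 1, Finset.mem_Icc.2 (by omega)⟩ :=
  dif_pos ⟨Finset.mem_Icc.2 (by omega), Finset.mem_Icc.2 (by omega)⟩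

theorem simpleTransposition_mul_self (n j : ℕ) :
    simpleTransposition n j * simpleTransposition n j = 1 := by
  unfold simpleTransposition
  split_ifs
  · exact Equiv.swap_mul_self _ _
  · exact one_mul 1

theorem simpleTransposition_mem_blockGroup {n j : ℕ} {D : Finset ℕ} (h1 : 1 ≤ j)
    (h2 : j ≤ n - 1) (hj : j ∈ D) : simpleTransposition n j ∈ blockGroup n D := by
  intro x
  rw [simpleTransposition_eq h1 h2]
  have h := blockLabel_succ_eq_iff.2 hj
  rw [Equiv.swap_apply_def]
  split_ifs with ha hb
  · simpa [ha] using h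
  · simpa [hb] using h.symm
  · rfl

/-! ### Lexicographic order -/

/-- The one-line notation of a permutation, ordered lexicographically. -/
def oneLine {n : ℕ} (w : Sym n) : Lex (interval n → interval n) := toLex w

theorem oneLine_injective {n : ℕ} : Function.Injective (oneLine (n := n)) :=
  fun _ _ h => DFunLike.coe_injective (toLex.injective h)

/-- The least position moved by `σ` is sent further right in its own run, where `w` is smaller; all
earlier values agree. -/
theorem oneLine_mul_le {n : ℕ} {w σ : Sym n} (hσ : σ ∈ blockGroup n (descentSet w)) :
    oneLine (w * σ) ≤ oneLine w := by
  by_cases hσ1 : σ = 1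
  · simp [hσ1]
  have hne : (Finset.univ.filter fun x => σ x ≠ x).Nonempty := by
    by_contra h
    rw [Finset.not_nonempty_iff_eq_empty, Finset.filter_eq_empty_iff] at h
    exact hσ1 (Equiv.ext fun x => not_not.1 (h (Finset.mem_univ x)))
  obtain ⟨x, hx, hmin⟩ := Finset.exists_min_image _ id hne
  have hfix : ∀ z < x, σ z = z := by
    intro z hz
    by_contra h
    exact absurd (hmin z (by simpa using h)) (not_le.2 hz)
  have hxσ : σ x ≠ x := (Finset.mem_filter.1 hx).2
  have hlt : x < σ x := by
    rcases lt_trichotomy x (σ x) with h | h | h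
    · exact h
    · exact absurd h.symm hxσ
    · exact absurd (σ.injective (hfix _ h)) hxσ
  have hval := value_lt_of_blockLabel_eq (w := w) (x := x) (y := σ x) hlt (hσ x).symm
  rw [value_coe, value_coe] at hval
  refine le_of_lt ⟨x, fun z hz => ?_, hval⟩
  change w (σ z) = w z
  rw [hfix z hz]

theorem oneLine_lt_mul_simpleTransposition {n j : ℕ} {w : Sym n} (h1 : 1 ≤ j) (h2 : j ≤ n - 1)
    (h : value w j < value w (j + 1)) : oneLine w < oneLine (w * simpleTransposition n j) := by
  have hj : j ∈ interval n := Finset.mem_Icc.2 (by omega)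
  have hj' : j + 1 ∈ interval n := Finset.mem_Icc.2 (by omega)
  rw [simpleTransposition_eq h1 h2]
  rw [value_of_mem w hj, value_of_mem w hj'] at h
  refine ⟨⟨j, hj⟩, fun z hz => ?_, ?_⟩
  · change w z = w (Equiv.swap _ _ z)
    have hz' : (z : ℕ) < j := hz
    rw [Equiv.swap_apply_of_ne_of_ne]
    · rintro rfl
      exact lt_irrefl _ hz'
    · rintro rfl
      simp at hz'
  · change w ⟨j, hj⟩ < w (Equiv.swap _ _ _)
    rw [Equiv.swap_apply_left]
    exact h

/-! ### Coset sums, invariant spaces and the filtration -/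

variable (k : Type*) [CommRing k]

open Classical in
/-- The sum of the coset of `w` modulo the Young subgroup generated by the `s_i` with
`i ∈ Des w`. -/
noncomputable def cosetSum {n : ℕ} (w : Sym n) : MonoidAlgebra k (Sym n) :=
  .ofCoeff (Finsupp.equivFunOnFinite.symm fun u =>
    if w⁻¹ * u ∈ blockGroup n (descentSet w) then 1 else 0)

open Classical in
theorem coeff_cosetSum {n : ℕ} (w u : Sym n) : (cosetSum k w).coeff u =
    if w⁻¹ * u ∈ blockGroup n (descentSet w) then 1 else 0 := rfl

theorem coeff_cosetSum_self {n : ℕ} (w : Sym n) : (cosetSum k w).coeff w = 1 := by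
  simp [coeff_cosetSum, one_mem]

theorem oneLine_le_of_coeff_cosetSum {n : ℕ} (w u : Sym n) (h : (cosetSum k w).coeff u ≠ 0) :
    oneLine u ≤ oneLine w := by
  rw [coeff_cosetSum] at h
  have hσ : w⁻¹ * u ∈ blockGroup n (descentSet w) := by
    by_contra hσ
    exact h (if_neg hσ)
  have := oneLine_mul_le hσ
  rwa [mul_inv_cancel_left] at this

variable {k}

theorem mem_invariantSpace {n : ℕ} {I : Finset ℕ} {q : MonoidAlgebra k (Sym n)} :
    q ∈ invariantSpace k n I ↔ ∀ j ∈ nonShadow n I, ∀ u,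
      q.coeff (u * simpleTransposition n j) = q.coeff u := by
  change (∀ j ∈ nonShadow n I, q * MonoidAlgebra.of k (Sym n) (simpleTransposition n j) = q) ↔ _
  refine forall₂_congr fun j _ => ?_
  have hinv : (simpleTransposition n j)⁻¹ = simpleTransposition n j :=
    inv_eq_of_mul_eq_one_left (simpleTransposition_mul_self n j)
  rw [← MonoidAlgebra.coeff_inj, DFunLike.ext_iff]
  refine forall_congr' fun u => ?_
  rw [MonoidAlgebra.of_apply, MonoidAlgebra.coeff_mul_single_apply, hinv, mul_one]

/-- An invariant `q` has equal coefficients at `w` and `w s_j` for `j ∈ I'`. If its leading `w` had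
an ascent at `j`, then `w s_j` would be a larger element of the support. -/
theorem invariantSpace_eq_span (n : ℕ) (I : Finset ℕ) : invariantSpace k n I =
    Submodule.span k (cosetSum k '' {w | nonShadow n I ⊆ descentSet w}) := by
  refine eq_span_of_leadingTerm oneLine_injective (coeff_cosetSum_self k)
    (oneLine_le_of_coeff_cosetSum k) (fun w hw => ?_) fun q hq w hqw hmax j hj => ?_
  · rw [mem_invariantSpace]
    intro j hj u
    have hb := (mem_nonShadow.1 hj).1
    rw [coeff_cosetSum, coeff_cosetSum, ← mul_assoc]
    congr 1
    exact propext (Subgroup.mul_mem_cancel_right _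
      (simpleTransposition_mem_blockGroup hb.1 hb.2 (hw hj)))
  · have hb := (mem_nonShadow.1 hj).1
    refine mem_descentSet.2 ⟨hb, ?_⟩
    by_contra hlt
    have hlt' := lt_of_le_of_ne (not_lt.1 hlt) (value_ne_value_succ w hb.1 hb.2)
    refine absurd (hmax (w * simpleTransposition n j) ?_)
      (not_le.2 (oneLine_lt_mul_simpleTransposition hb.1 hb.2 hlt'))
    rwa [mem_invariantSpace.1 hq j hj]

variable (k)

/-- The basis of `k[S_n]` formed by the coset sums. -/
noncomputable def cosetSumBasis (n : ℕ) : Module.Basis (Sym n) k (MonoidAlgebra k (Sym n)) :=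
  .mk (linearIndependent_of_unitriangular oneLine_injective (coeff_cosetSum_self k)
    (oneLine_le_of_coeff_cosetSum k))
    (by
      rw [← Set.image_univ, ← eq_span_of_leadingTerm (F := ⊤) oneLine_injective
        (coeff_cosetSum_self k) (oneLine_le_of_coeff_cosetSum k)] <;> simp)

theorem coe_cosetSumBasis (n : ℕ) : ⇑(cosetSumBasis k n) = cosetSum k :=
  Module.Basis.coe_mk _ _

theorem filtration_eq_span (n : ℕ) (Q : ℕ → Finset ℕ) (i : ℕ) : filtration k n Q i =
    Submodule.span k (cosetSumBasis k n ''
      {w | ∃ m ∈ Finset.Icc 1 i, nonShadow n (Q m) ⊆ descentSet w}) := by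
  have : {w : Sym n | ∃ m ∈ Finset.Icc 1 i, nonShadow n (Q m) ⊆ descentSet w} =
      ⋃ m ∈ Finset.Icc 1 i, {w | nonShadow n (Q m) ⊆ descentSet w} := by
    ext w
    simp
  rw [this, coe_cosetSumBasis]
  simp only [Set.image_iUnion, Submodule.span_iUnion, filtration, invariantSpace_eq_span]

theorem qIndex_eq_iff {n : ℕ} {Q : ℕ → Finset ℕ} {i : ℕ}
    (hi : i ∈ Finset.Icc 1 (Nat.fib (n + 1))) {w : Sym n} :
    qIndex Q w = i ↔ nonShadow n (Q i) ⊆ descentSet w ∧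
      ∀ m ∈ Finset.Icc 1 (i - 1), ¬ nonShadow n (Q m) ⊆ descentSet w := by
  have hi' := Finset.mem_Icc.1 hi
  constructor
  · rintro rfl
    have hne : {m : ℕ | m ∈ interval (Nat.fib (n + 1)) ∧
        nonShadow n (Q m) ⊆ descentSet w}.Nonempty := by
      by_contra h
      rw [Set.not_nonempty_iff_eq_empty] at h
      -- The default `sInf ∅ = 0` is ruled out by `1 ≤ i`.
      rw [qIndex, h, Nat.sInf_empty] at hi'
      omega
    refine ⟨(Nat.sInf_mem hne).2, fun m hm hsub => ?_⟩
    have hm' := Finset.mem_Icc.1 hm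
    have : qIndex Q w ≤ m := Nat.sInf_le ⟨Finset.mem_Icc.2 (by omega), hsub⟩
    omega
  · rintro ⟨h1, h2⟩
    refine le_antisymm (Nat.sInf_le ⟨hi, h1⟩) (le_csInf ⟨i, hi, h1⟩ ?_)
    rintro m ⟨hm, hsub⟩
    by_contra hlt
    have hm' := Finset.mem_Icc.1 hm
    exact h2 m (Finset.mem_Icc.2 (by omega)) hsub

/-- The coset sums of the permutations with `Q`-index `i` form a basis of `F_i / F_{i-1}`. -/
noncomputable def subquotientBasis {n : ℕ} (Q : ℕ → Finset ℕ) {i : ℕ}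
    (hi : i ∈ Finset.Icc 1 (Nat.fib (n + 1))) :
    Module.Basis (Fin (delta n Q i)) k (Subquotient k n Q i) :=
  (quotientSpanBasis (cosetSumBasis k n)
    (filtration_eq_span k n Q i) (filtration_eq_span k n Q (i - 1))).reindex
  ((Equiv.subtypeEquivRight fun w => by
      have hi' := Finset.mem_Icc.1 hi
      rw [qIndex_eq_iff hi]
      constructor
      · rintro ⟨⟨m, hm, h⟩, hT⟩
        have hT' : ∀ m ∈ Finset.Icc 1 (i - 1), ¬ nonShadow n (Q m) ⊆ descentSet w :=
          fun m hm h => hT ⟨m, hm, h⟩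
        refine ⟨?_, hT'⟩
        have hm' := Finset.mem_Icc.1 hm
        rcases eq_or_ne m i with rfl | hne
        · exact h
        · exact absurd h (hT' m (Finset.mem_Icc.2 (by omega)))
      · rintro ⟨h1, h2⟩
        refine ⟨⟨i, Finset.mem_Icc.2 (by omega), h1⟩, ?_⟩
        rintro ⟨m, hm, h⟩
        exact h2 m hm h).trans
    (Finite.equivFin {w : Sym n // qIndex Q w = i}))

/-! ### Lacunar sets and ascent-descent patterns -/

/-- Greedy choice from the top: take the maximum `M`, discard `M - 1`, and recurse below. It is
applied to the set of ascents of `w`. -/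
theorem exists_isLacunar_cover (A : Finset ℕ) :
    ∃ I ⊆ A, IsLacunar I ∧ ∀ x ∈ A, x ∈ I ∨ x + 1 ∈ I := by
  induction A using Finset.strongInduction with
  | H A ih =>
    rcases A.eq_empty_or_nonempty with rfl | hne
    · exact ⟨∅, subset_rfl, by simp [IsLacunar], by simp⟩
    set M := A.max' hne with hM
    have hMA : M ∈ A := A.max'_mem hne
    have hle : ∀ x ∈ A, x ≤ M := A.le_max'
    obtain ⟨I, hIA, hI, hcov⟩ := ih (A.filter (· + 1 < M))
      (Finset.filter_ssubset.2 ⟨M, hMA, by omega⟩)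
    have hIM : ∀ x ∈ I, x + 1 < M := fun x hx => (Finset.mem_filter.1 (hIA hx)).2
    refine ⟨insert M I, ?_, ?_, ?_⟩
    · intro x hx
      rcases Finset.mem_insert.1 hx with rfl | hx
      · exact hMA
      · exact Finset.mem_of_mem_filter x (hIA hx)
    · intro x hx hx'
      rcases Finset.mem_insert.1 hx with rfl | hx <;>
        rcases Finset.mem_insert.1 hx' with hx' | hx'
      · omega
      · have := hIM _ hx'
        omega
      · have := hIM _ hx
        omega
      · exact hI x hx hx'
    · intro x hx
      have := hle x hx
      by_cases h : x + 1 < M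
      · exact (hcov x (Finset.mem_filter.2 ⟨hx, h⟩)).imp Finset.mem_insert_of_mem
          Finset.mem_insert_of_mem
      · rcases (by omega : x = M ∨ x + 1 = M) with h | h
        · exact .inl (h ▸ Finset.mem_insert_self _ _)
        · exact .inr (h ▸ Finset.mem_insert_self _ _)

/-- Send `x` to itself if it lies in `K` and to `x + 1` otherwise; lacunarity makes this injective
into `K`. Some element strictly increases unless `I ⊆ K`, and then `K` has an extra, positive
element. -/
theorem IsLacunar.sum_lt_sum {I K : Finset ℕ} (hI : IsLacunar I) (hK0 : 0 ∉ K)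
    (hcov : ∀ x ∈ I, x ∈ K ∨ x + 1 ∈ K) (hne : I ≠ K) : ∑ x ∈ I, x < ∑ x ∈ K, x := by
  by_cases hIK : I ⊆ K
  · obtain ⟨x, hx, hxI⟩ := Finset.exists_of_ssubset (hIK.ssubset_of_ne hne)
    refine Finset.sum_lt_sum_of_subset hIK hx hxI (Nat.pos_of_ne_zero ?_) fun _ _ _ => Nat.zero_le _
    rintro rfl
    exact hK0 hx
  · obtain ⟨y, hy, hyK⟩ := Finset.not_subset.1 hIK
    let f : ℕ → ℕ := fun x => if x ∈ K then x else x + 1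
    have hinj : Set.InjOn f I := by
      intro x hx x' hx' h
      have h1 := hI x hx
      have h2 := hI x' hx'
      simp only [f] at h
      split_ifs at h
      · exact h
      · subst h
        exact absurd hx h2
      · subst h
        exact absurd hx' h1
      · omega
    calc ∑ x ∈ I, x < ∑ x ∈ I, f x := by
          refine Finset.sum_lt_sum (fun x _ => ?_) ⟨y, hy, ?_⟩
          · simp only [f]
            split_ifs <;> omega
          · simp [f, hyK]
      _ = ∑ x ∈ I.image f, x := by rw [Finset.sum_image hinj]
      _ ≤ ∑ x ∈ K, x := by
          refine Finset.sum_le_sum_of_subset fun z hz => ?_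
          obtain ⟨x, hx, rfl⟩ := Finset.mem_image.1 hz
          simp only [f]
          split_ifs with h
          · exact h
          · exact (hcov x hx).resolve_left h

/-- `w` ascends at every element of `I` and descends at every element of `I'`. -/
def HasPattern {n : ℕ} (I : Finset ℕ) (w : Sym n) : Prop :=
  (∀ j ∈ I, value w j < value w (j + 1)) ∧ ∀ j ∈ nonShadow n I, value w j > value w (j + 1)

theorem HasPattern.nonShadow_subset {n : ℕ} {I : Finset ℕ} {w : Sym n} (h : HasPattern I w) :
    nonShadow n I ⊆ descentSet w := fun j hj =>
  mem_descentSet.2 ⟨(mem_nonShadow.1 hj).1, h.2 j hj⟩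

/-- An element of `I` is an ascent of `w`, so it is not in `K'`: it or its successor lies in `K`. -/
theorem HasPattern.eq_or_sum_lt {n : ℕ} {I K : Finset ℕ} {w : Sym n} (h : HasPattern I w)
    (hIn : I ⊆ interval (n - 1)) (hI : IsLacunar I) (hKn : K ⊆ interval (n - 1))
    (hKw : nonShadow n K ⊆ descentSet w) : I = K ∨ ∑ x ∈ I, x < ∑ x ∈ K, x := by
  by_cases hne : I = K
  · exact .inl hne
  refine .inr (hI.sum_lt_sum (fun h0 => by simpa using hKn h0) (fun x hx => ?_) hne)
  by_contra hx'
  push Not at hx'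
  exact lt_asymm (h.1 x hx)
    (mem_descentSet.1 (hKw (mem_nonShadow.2 ⟨Finset.mem_Icc.1 (hIn hx), hx'⟩))).2

theorem exists_hasPattern {n : ℕ} (w : Sym n) :
    ∃ I ⊆ interval (n - 1), IsLacunar I ∧ HasPattern I w := by
  obtain ⟨I, hIA, hI, hcov⟩ := exists_isLacunar_cover (interval (n - 1) \ descentSet w)
  refine ⟨I, fun x hx => (Finset.mem_sdiff.1 (hIA hx)).1, hI, fun j hj => ?_, fun j hj => ?_⟩
  · have h := Finset.mem_sdiff.1 (hIA hj)
    have hb := Finset.mem_Icc.1 h.1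
    rw [mem_descentSet, not_and, not_lt] at h
    exact lt_of_le_of_ne (h.2 hb) (value_ne_value_succ w hb.1 hb.2)
  · have hj' := mem_nonShadow.1 hj
    by_contra hlt
    rcases hcov j (Finset.mem_sdiff.2 ⟨Finset.mem_Icc.2 hj'.1, fun h =>
      hlt (mem_descentSet.1 h).2⟩) with h | h
    · exact hj'.2.1 h
    · exact hj'.2.2 h

theorem qIndex_eq_of_hasPattern {n : ℕ} {Q : ℕ → Finset ℕ} (hQ : IsLacunarListing n Q) {i : ℕ}
    (hi : i ∈ Finset.Icc 1 (Nat.fib (n + 1))) {w : Sym n} (h : HasPattern (Q i) w) :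
    qIndex Q w = i := by
  have hi' := Finset.mem_Icc.1 hi
  refine (qIndex_eq_iff hi).2 ⟨h.nonShadow_subset, fun m hm hmw => ?_⟩
  have hm' := Finset.mem_Icc.1 hm
  have hmI : m ∈ Set.Icc 1 (Nat.fib (n + 1)) := ⟨hm'.1, by omega⟩
  have hQi := hQ.bijOn.mapsTo hi'
  rcases h.eq_or_sum_lt hQi.1 hQi.2 (hQ.bijOn.mapsTo hmI).1 hmw with heq | hlt
  · have := hQ.bijOn.injOn hi' hmI heq
    omega
  · exact absurd (hQ.sum_mono hmI hi' (by omega)) (not_le.2 hlt)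

theorem qIndex_eq_iff_hasPattern {n : ℕ} {Q : ℕ → Finset ℕ} (hQ : IsLacunarListing n Q) {i : ℕ}
    (hi : i ∈ Finset.Icc 1 (Nat.fib (n + 1))) {w : Sym n} :
    qIndex Q w = i ↔ HasPattern (Q i) w := by
  refine ⟨?_, qIndex_eq_of_hasPattern hQ hi⟩
  rintro rfl
  obtain ⟨I, hIn, hI, hw⟩ := exists_hasPattern w
  obtain ⟨m, hm, rfl⟩ := hQ.bijOn.surjOn ⟨hIn, hI⟩
  rwa [qIndex_eq_of_hasPattern hQ (Finset.mem_Icc.2 hm) hw]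

theorem delta_eq_card_hasPattern {n : ℕ} {Q : ℕ → Finset ℕ} (hQ : IsLacunarListing n Q) {i : ℕ}
    (hi : i ∈ Finset.Icc 1 (Nat.fib (n + 1))) :
    delta n Q i = Nat.card {w : Sym n // HasPattern (Q i) w} :=
  Nat.card_congr (Equiv.subtypeEquivRight fun _ => qIndex_eq_iff_hasPattern hQ hi)

/-! ### Counting orders within blocks -/

section Counting

open Finset

theorem card_strictAnti_comp_perm {r : ℕ} {f : Fin r → ℕ} (hf : Function.Injective f) :
    Nat.card {σ : Equiv.Perm (Fin r) // StrictAnti (f ∘ σ)} = 1 := by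
  rw [Nat.card_eq_one_iff_unique]
  refine ⟨⟨fun σ τ => Subtype.ext (Equiv.ext fun x => hf ?_)⟩, ⟨⟨Tuple.sort (OrderDual.toDual ∘ f), ?_⟩⟩⟩
  · exact congrFun (Tuple.unique_antitone σ.2.antitone τ.2.antitone) x
  · have h : Antitone (f ∘ Tuple.sort (OrderDual.toDual ∘ f)) :=
      fun x y hxy => Tuple.monotone_sort (OrderDual.toDual ∘ f) hxy
    exact h.strictAnti_of_injective (hf.comp (Equiv.injective _))

/-- The image `c` of 0 is free; the order of the remaining entries is then forced. -/
theorem card_strictAnti_tail_comp_perm {s : ℕ} {f : Fin (s + 1) → ℕ}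
    (hf : Function.Injective f) :
    Nat.card {σ : Equiv.Perm (Fin (s + 1)) // StrictAnti fun x : Fin s => f (σ x.succ)} =
      s + 1 := by
  let T : Fin (s + 1) → Equiv.Perm (Fin s) → Prop := fun c τ =>
    StrictAnti ((fun x : Fin s => f (Equiv.swap 0 c x.succ)) ∘ τ)
  have e : {σ : Equiv.Perm (Fin (s + 1)) // StrictAnti fun x : Fin s => f (σ x.succ)} ≃
      Σ c, {τ // T c τ} :=
    (Equiv.subtypeEquiv Equiv.Perm.decomposeFin fun σ => by
      obtain ⟨⟨c, τ⟩, rfl⟩ := Equiv.Perm.decomposeFin.symm.surjective σ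
      simp only [Equiv.Perm.decomposeFin_symm_apply_succ, Equiv.apply_symm_apply]
      exact Iff.rfl : _ ≃ {p : Fin (s + 1) × Equiv.Perm (Fin s) // T p.1 p.2}).trans
    (Equiv.subtypeProdEquivSigmaSubtype T)
  rw [Nat.card_congr e, Nat.card_sigma]
  have : ∀ c, Nat.card {τ // T c τ} = 1 := fun c =>
    card_strictAnti_comp_perm (hf.comp ((Equiv.injective _).comp (Fin.succ_injective s)))
  rw [sum_congr rfl fun c _ => this c]
  simp

/-- `f` ascends at the positions below `d` and descends at the others. -/
def DescendsFrom (d : ℕ) {r : ℕ} (f : Fin r → ℕ) : Prop :=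
  ∀ (x : ℕ) (h : x + 1 < r),
    (x < d → f ⟨x, by omega⟩ < f ⟨x + 1, h⟩) ∧ (d ≤ x → f ⟨x + 1, h⟩ < f ⟨x, by omega⟩)

theorem descendsFrom_zero_iff {r : ℕ} {f : Fin r → ℕ} : DescendsFrom 0 f ↔ StrictAnti f := by
  constructor
  · intro h
    cases r with
    | zero => exact fun x => x.elim0
    | succ r => exact Fin.strictAnti_iff_succ_lt.2 fun x => (h x (by omega)).2 (Nat.zero_le _)
  · intro h x hx
    exact ⟨fun h => absurd h (Nat.not_lt_zero _), fun _ => h (Fin.mk_lt_mk.2 (Nat.lt_succ_self x))⟩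

theorem descendsFrom_one_iff {s : ℕ} {f : Fin (s + 2) → ℕ} :
    DescendsFrom 1 f ↔ (StrictAnti fun x : Fin (s + 1) => f x.succ) ∧ f 0 < f 1 := by
  rw [← descendsFrom_zero_iff]
  constructor
  · intro h
    exact ⟨fun x hx => ⟨fun h => absurd h (Nat.not_lt_zero _), fun _ =>
      (h (x + 1) (by omega)).2 (by omega)⟩, (h 0 (by omega)).1 one_pos⟩
  · rintro ⟨h, h0⟩ x hx
    cases x with
    | zero => exact ⟨fun _ => h0, fun h => absurd h (by omega)⟩
    | succ x => exact ⟨fun h => absurd h (by omega), fun _ => (h x (by omega)).2 (Nat.zero_le _)⟩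

theorem card_descendsFrom_zero {r : ℕ} {f : Fin r → ℕ} (hf : Function.Injective f) :
    Nat.card {σ : Equiv.Perm (Fin r) // DescendsFrom 0 (f ∘ σ)} = 1 := by
  simp only [descendsFrom_zero_iff]
  exact card_strictAnti_comp_perm hf

/-- Among the `r` arrangements with decreasing tail, exactly one does not ascend at the start,
namely the fully decreasing one. -/
theorem card_descendsFrom_one {r : ℕ} (hr : 2 ≤ r) {f : Fin r → ℕ} (hf : Function.Injective f) :
    Nat.card {σ : Equiv.Perm (Fin r) // DescendsFrom 1 (f ∘ σ)} = r - 1 := by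
  classical
  obtain ⟨s, rfl⟩ := Nat.exists_eq_add_of_le' hr
  have h1 := card_strictAnti_comp_perm hf
  have h2 := card_strictAnti_tail_comp_perm hf
  simp only [descendsFrom_one_iff]
  rw [Nat.card_eq_fintype_card, Fintype.card_subtype] at h1 h2 ⊢
  rw [← card_filter_add_card_filter_not (fun σ : Equiv.Perm (Fin (s + 2)) => f (σ 0) < f (σ 1)),
    filter_filter, filter_filter] at h2
  have h3 : ∀ σ : Equiv.Perm (Fin (s + 2)), StrictAnti (f ∘ σ) ↔
      (StrictAnti fun x : Fin (s + 1) => f (σ x.succ)) ∧ ¬ f (σ 0) < f (σ 1) := by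
    intro σ
    constructor
    · exact fun h => ⟨fun x y hxy => h (Fin.succ_lt_succ_iff.2 hxy),
        not_lt.2 (h (by simp : (0 : Fin (s + 2)) < 1)).le⟩
    · rintro ⟨h, h0⟩
      refine Fin.strictAnti_iff_succ_lt.2 fun x => ?_
      refine Fin.cases ?_ (fun y => ?_) x
      · refine lt_of_le_of_ne (not_lt.1 h0) fun h => ?_
        simpa using σ.injective (hf h)
      · exact h (by simp [Fin.lt_def] : y.castSucc < y.succ)
  simp only [h3] at h1
  rw [h1] at h2
  simp only [Function.comp_apply]
  omega

/-- Splitting the positions into blocks, the relative orders within the blocks are independent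
and uniformly distributed. -/
theorem card_blockwise_mul_prod_factorial {ι : Type*} [Fintype ι] {n : ℕ} {r : ι → ℕ}
    (e : (Σ m, Fin (r m)) ≃ interval n) (P : ∀ m, (Fin (r m) → ℕ) → Prop) (c : ι → ℕ)
    (hc : ∀ m (f : Fin (r m) → ℕ), Function.Injective f →
      Nat.card {τ : Equiv.Perm (Fin (r m)) // P m (f ∘ τ)} = c m) :
    Nat.card {w : Sym n // ∀ m, P m fun x => w (e ⟨m, x⟩)} * ∏ m, (r m)! = n ! * ∏ m, c m := by
  classical
  -- Double count pairs `(w, τ)` such that `w` rearranged by `τ` within blocks satisfies every `P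
  -- m`. A fixed `w` admits `∏ c m` choices of `τ`; for a fixed `τ`, right multiplication matches
  -- the valid `w` with those for `τ = 1`.
  have h := sum_card_bipartiteAbove_eq_sum_card_bipartiteBelow
    (s := (univ : Finset (Sym n))) (t := (univ : Finset (∀ m, Equiv.Perm (Fin (r m)))))
    (fun w τ => ∀ m, P m fun x => w (e ⟨m, τ m x⟩))
  have hl : ∀ w ∈ (univ : Finset (Sym n)),
      #(bipartiteAbove (fun (w : Sym n) (τ : ∀ m, Equiv.Perm (Fin (r m))) =>
        ∀ m, P m fun x => w (e ⟨m, τ m x⟩)) univ w) = ∏ m, c m := by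
    intro w _
    rw [bipartiteAbove, ← Fintype.card_subtype, ← Nat.card_eq_fintype_card,
      Nat.card_congr (Equiv.subtypePiEquivPi
        (p := fun m (τ : Equiv.Perm (Fin (r m))) => P m fun x => w (e ⟨m, τ x⟩))), Nat.card_pi]
    refine prod_congr rfl fun m _ => hc m (fun x => w (e ⟨m, x⟩)) fun x y hxy => ?_
    simpa using hxy
  have hr : ∀ τ ∈ (univ : Finset (∀ m, Equiv.Perm (Fin (r m)))),
      #(bipartiteBelow (fun (w : Sym n) (τ : ∀ m, Equiv.Perm (Fin (r m))) =>
        ∀ m, P m fun x => w (e ⟨m, τ m x⟩)) univ τ) =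
        Nat.card {w : Sym n // ∀ m, P m fun x => w (e ⟨m, x⟩)} := by
    intro τ _
    rw [bipartiteBelow, ← Fintype.card_subtype, ← Nat.card_eq_fintype_card]
    refine Nat.card_congr (Equiv.subtypeEquiv
      (Equiv.mulRight (e.permCongr (Equiv.Perm.sigmaCongrRight τ))) fun w => ?_)
    simp [Equiv.permCongr_apply]
  rw [sum_congr rfl hl, sum_congr rfl hr] at h
  simp only [sum_const, card_univ, smul_eq_mul, Fintype.card_perm, Fintype.card_pi,
    Fintype.card_fin, Fintype.card_coe, Nat.card_Icc, Nat.add_sub_cancel] at h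
  rw [mul_comm, ← h]

end Counting

/-! ### Blocks cut out by a lacunar set -/

/-- `I = {a 1 < ⋯ < a p}` is a lacunar subset of `[n - 1]`, with the conventions `a 0 = 1` and
`a (p + 1) = n + 1`, and `j m` is the length of the block of positions from `a (m - 1)` up to
`a m - 1`. -/
structure IsBlockListing (n : ℕ) (I : Finset ℕ) (p : ℕ) (a j : ℕ → ℕ) : Prop where
  subset : I ⊆ interval (n - 1)
  lacunar : IsLacunar I
  strictMonoOn : StrictMonoOn a (Set.Icc 1 p)
  eq_image : I = (Finset.Icc 1 p).image a
  first : a 0 = 1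
  last : a (p + 1) = n + 1
  add_eq : ∀ m ≤ p, a m + j (m + 1) = a (m + 1)

namespace IsBlockListing

variable {n p : ℕ} {I : Finset ℕ} {a j : ℕ → ℕ}

theorem mem_of_mem_Icc (h : IsBlockListing n I p a j) {m : ℕ} (h1 : 1 ≤ m) (h2 : m ≤ p) :
    a m ∈ I :=
  h.eq_image ▸ Finset.mem_image_of_mem a (Finset.mem_Icc.2 ⟨h1, h2⟩)

theorem exists_eq_of_mem (h : IsBlockListing n I p a j) {x : ℕ} (hx : x ∈ I) :
    ∃ m, 1 ≤ m ∧ m ≤ p ∧ a m = x := by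
  rw [h.eq_image] at hx
  obtain ⟨m, hm, rfl⟩ := Finset.mem_image.1 hx
  exact ⟨m, (Finset.mem_Icc.1 hm).1, (Finset.mem_Icc.1 hm).2, rfl⟩

theorem bounds (h : IsBlockListing n I p a j) {m : ℕ} (h1 : 1 ≤ m) (h2 : m ≤ p) :
    1 ≤ a m ∧ a m ≤ n - 1 :=
  Finset.mem_Icc.1 (h.subset (h.mem_of_mem_Icc h1 h2))

theorem one_le (h : IsBlockListing n I p a j) {m : ℕ} (hm : m ≤ p) : 1 ≤ a m := by
  rcases Nat.eq_zero_or_pos m with rfl | h1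
  · exact h.first.ge
  · exact (h.bounds h1 hm).1

theorem le_last (h : IsBlockListing n I p a j) {m : ℕ} (h1 : 1 ≤ m) (h2 : m ≤ p + 1) :
    a m ≤ n + 1 := by
  rcases h2.eq_or_lt with rfl | h2
  · exact h.last.le
  · have := (h.bounds h1 (by omega)).2
    omega

/-- Lacunarity gives gaps of at least 2 inside `I`; the last block uses `a p ≤ n - 1` and `a (p + 1)
= n + 1`. -/
theorem two_le (h : IsBlockListing n I p a j) {m : ℕ} (h1 : 1 ≤ m) (h2 : m ≤ p) :
    2 ≤ j (m + 1) := by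
  have hadd := h.add_eq m h2
  have hb := h.bounds h1 h2
  rcases h2.eq_or_lt with rfl | h2
  · have := h.last
    omega
  · have hlt := h.strictMonoOn (Set.mem_Icc.2 ⟨h1, h2.le⟩)
      (Set.mem_Icc.2 ⟨by omega, h2⟩ : m + 1 ∈ _) (Nat.lt_succ_self m)
    have hlac := h.lacunar _ (h.mem_of_mem_Icc h1 h2.le)
    by_contra hlt2
    have : a m + 1 = a (m + 1) := by omega
    rw [this] at hlac
    exact hlac (h.mem_of_mem_Icc (by omega) h2)

theorem notMem_of_lt (h : IsBlockListing n I p a j) {m x : ℕ} (hm : m ≤ p)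
    (hx : m = 0 ∨ a m < x) (hx' : x < a (m + 1)) : x ∉ I := by
  intro hxI
  obtain ⟨t, ht1, ht2, rfl⟩ := h.exists_eq_of_mem hxI
  by_cases htm : t ≤ m
  · have := h.strictMonoOn.monotoneOn (Set.mem_Icc.2 ⟨ht1, ht2⟩)
      (Set.mem_Icc.2 ⟨by omega, hm⟩) htm
    omega
  · have := h.strictMonoOn.monotoneOn (Set.mem_Icc.2 ⟨by omega, by omega⟩ : m + 1 ∈ _)
      (Set.mem_Icc.2 ⟨ht1, ht2⟩) (by omega)
    omega

theorem exists_block (h : IsBlockListing n I p a j) {y : ℕ} (h1 : 1 ≤ y) (h2 : y ≤ n) :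
    ∃ m ≤ p, ∃ x < j (m + 1), a m + x = y := by
  have h0 : a 0 ≤ y := h.first.le.trans h1
  -- Taking the greatest such `m` skips the first block when it is empty, which happens if `a 1 =
  -- 1`.
  have hm := Nat.findGreatest_spec (P := fun m => a m ≤ y) (Nat.zero_le p) h0
  have hle := Nat.findGreatest_le (P := fun m => a m ≤ y) p
  have hgt : ∀ k, Nat.findGreatest (fun m => a m ≤ y) p < k → k ≤ p → ¬ a k ≤ y :=
    fun k hk hkp => Nat.findGreatest_is_greatest (P := fun m => a m ≤ y) hk hkp
  generalize Nat.findGreatest (fun m => a m ≤ y) p = m at hm hle hgt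
  have hadd := h.add_eq m hle
  have hlt : y < a (m + 1) := by
    rcases hle.eq_or_lt with rfl | hlt
    · rw [h.last]
      omega
    · exact not_le.1 (hgt (m + 1) (by omega) hlt)
  exact ⟨m, hle, y - a m, by omega, by omega⟩

theorem add_le (h : IsBlockListing n I p a j) {m x : ℕ} (hm : m ≤ p) (hx : x < j (m + 1)) :
    a m + x ≤ n := by
  have h1 := h.add_eq m hm
  have h2 := h.le_last (m := m + 1) (by omega) (by omega)
  omega

theorem sum_range (h : IsBlockListing n I p a j) : ∑ m ∈ Finset.range (p + 1), j (m + 1) = n := by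
  have key : ∀ s ≤ p + 1, ∑ m ∈ Finset.range s, j (m + 1) + 1 = a s := by
    intro s
    induction s with
    | zero => simp [h.first]
    | succ s ih =>
      intro hs
      rw [Finset.sum_range_succ, ← h.add_eq s (by omega), ← ih (by omega)]
      omega
  have := key (p + 1) le_rfl
  rw [h.last] at this
  omega

/-- The position of the `x`-th element of the `m`-th block. -/
def position (h : IsBlockListing n I p a j) (z : Σ m : Fin (p + 1), Fin (j (m + 1))) :
    interval n :=
  ⟨a z.1 + z.2, Finset.mem_Icc.2
    ⟨(h.one_le (Nat.lt_succ_iff.1 z.1.2)).trans (Nat.le_add_right _ _),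
      h.add_le (Nat.lt_succ_iff.1 z.1.2) z.2.2⟩⟩

theorem position_bijective (h : IsBlockListing n I p a j) : Function.Bijective h.position := by
  rw [Fintype.bijective_iff_surjective_and_card]
  constructor
  · rintro ⟨y, hy⟩
    obtain ⟨m, hm, x, hx, hxy⟩ := h.exists_block (Finset.mem_Icc.1 hy).1 (Finset.mem_Icc.1 hy).2
    exact ⟨⟨⟨m, by omega⟩, ⟨x, hx⟩⟩, Subtype.ext hxy⟩
  · simp only [Fintype.card_sigma, Fintype.card_fin, Fintype.card_coe, Nat.card_Icc,
      Nat.add_sub_cancel]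
    rw [Fin.sum_univ_eq_sum_range (fun m => j (m + 1)), h.sum_range]

/-- The bound `min m 1` is 0 for the first block, whose start `a 0 = 1` is only a convention, and 1
for the others, which start at an ascent. The step from one block into the next is unconstrained,
since the next block starts in `I`. -/
theorem hasPattern_iff (h : IsBlockListing n I p a j) (w : Sym n) :
    HasPattern I w ↔ ∀ m : Fin (p + 1),
      DescendsFrom (min m 1) fun x : Fin (j (m + 1)) => value w (a m + x) := by
  constructor
  · rintro ⟨hasc, hdesc⟩ ⟨m, hm⟩ x hx
    dsimp only at hx ⊢
    have hmp : m ≤ p := by omega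
    have hadd := h.add_eq m hmp
    have h1 := h.one_le hmp
    have hle := h.add_le hmp hx
    refine ⟨fun hxd => ?_, fun hxd => ?_⟩
    · obtain rfl : x = 0 := by omega
      exact hasc _ (h.mem_of_mem_Icc (by omega) hmp)
    · refine hdesc (a m + x) (mem_nonShadow.2 ⟨⟨by omega, by omega⟩, ?_, ?_⟩)
      · exact h.notMem_of_lt hmp (by omega) (by omega)
      · exact h.notMem_of_lt hmp (by omega) (by omega)
  · intro hw
    constructor
    · intro y hy
      obtain ⟨m, h1, h2, rfl⟩ := h.exists_eq_of_mem hy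
      exact (hw ⟨m, by omega⟩ 0 (h.two_le h1 h2)).1 (by dsimp only; omega)
    · intro y hy
      obtain ⟨hb, hy1, hy2⟩ := mem_nonShadow.1 hy
      obtain ⟨m, hm, x, hx, rfl⟩ := h.exists_block hb.1 (by omega)
      have hadd := h.add_eq m hm
      refine (hw ⟨m, by omega⟩ x ?_).2 ?_
      · by_contra hlt
        dsimp only at hlt
        have heq : a m + x + 1 = a (m + 1) := by omega
        rcases hm.eq_or_lt with rfl | hm
        · have := h.last
          omega
        · exact hy2 (heq ▸ h.mem_of_mem_Icc (by omega) hm)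
      · by_contra hlt
        dsimp only at hlt
        obtain rfl : x = 0 := by omega
        exact hy1 (h.mem_of_mem_Icc (by omega) hm)

theorem card_hasPattern_mul (h : IsBlockListing n I p a j) :
    Nat.card {w : Sym n // HasPattern I w} * ∏ m ∈ Finset.range (p + 1), (j (m + 1))! =
      n ! * ∏ m ∈ Finset.range p, (j (m + 2) - 1) := by
  have key := card_blockwise_mul_prod_factorial (Equiv.ofBijective _ h.position_bijective)
    (fun m => DescendsFrom (min m 1)) (fun m => if (m : ℕ) = 0 then 1 else j (m + 1) - 1) ?_
  · rw [Fin.prod_univ_eq_prod_range (fun m => (j (m + 1))!),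
      Fin.prod_univ_eq_prod_range (fun m => if m = 0 then 1 else j (m + 1) - 1),
      Finset.prod_range_succ' (fun m => if m = 0 then 1 else j (m + 1) - 1)] at key
    simp only [Nat.add_eq_zero_iff, one_ne_zero, and_false, if_false, if_true, mul_one] at key
    rw [← key]
    congr 1
    refine Nat.card_congr (Equiv.subtypeEquivRight fun w => ?_)
    rw [h.hasPattern_iff]
    refine forall_congr' fun m => ?_
    simp only [← value_coe, Equiv.ofBijective_apply, position]
  · rintro ⟨m, hm⟩ f hf
    dsimp only at f ⊢
    rcases Nat.eq_zero_or_pos m with rfl | h1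
    · exact card_descendsFrom_zero hf
    · rw [Nat.min_eq_right h1, if_neg h1.ne']
      exact card_descendsFrom_one (h.two_le h1 (by omega)) hf

theorem card_hasPattern_eq (h : IsBlockListing n I p a j) :
    Nat.card {w : Sym n // HasPattern I w} =
      Nat.multinomial (Finset.Icc 1 (p + 1)) j * ∏ m ∈ Finset.range p, (j (m + 2) - 1) := by
  have hIcc : Finset.Icc 1 (p + 1) = Finset.Ico (0 + 1) (p + 1 + 1) := rfl
  have hspec := Nat.multinomial_spec (Finset.Icc 1 (p + 1)) j
  rw [hIcc, ← Finset.prod_Ico_add' (fun m => (j m)!), ← Finset.sum_Ico_add' j,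
    ← Finset.range_eq_Ico, h.sum_range, ← hIcc] at hspec
  refine Nat.eq_of_mul_eq_mul_right
    (Finset.prod_pos fun m (_ : m ∈ Finset.range (p + 1)) => (j (m + 1)).factorial_pos) ?_
  rw [h.card_hasPattern_mul, ← hspec]
  ring

/-- Each `j - 1` divides `j!`, so the product formula leaves an integral cofactor once the positive
factors `j - 1` are cancelled. -/
theorem card_hasPattern_dvd (h : IsBlockListing n I p a j) :
    Nat.card {w : Sym n // HasPattern I w} ∣ n ! := by
  have hpos : 0 < ∏ m ∈ Finset.range p, (j (m + 2) - 1) := Finset.prod_pos fun m hm => by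
    have : 2 ≤ j (m + 2) := h.two_le (by omega) (Finset.mem_range.1 hm)
    omega
  have hdvd : ∏ m ∈ Finset.range p, (j (m + 2) - 1) ∣
      ∏ m ∈ Finset.range (p + 1), (j (m + 1))! := by
    rw [Finset.prod_range_succ' (fun m => (j (m + 1))!)]
    refine (Finset.prod_dvd_prod_of_dvd _ _ fun m hm => ?_).trans (dvd_mul_right _ _)
    have : 2 ≤ j (m + 2) := h.two_le (by omega) (Finset.mem_range.1 hm)
    exact Nat.dvd_factorial (by omega) (Nat.sub_le _ _)
  obtain ⟨t, ht⟩ := hdvd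
  have key := h.card_hasPattern_mul
  rw [ht] at key
  refine ⟨t, Nat.eq_of_mul_eq_mul_right hpos ?_⟩
  rw [← key]
  ring

end IsBlockListing

/-- Divisibility is claimed without a given enumeration of `Q i`, so one has to be constructed. -/
theorem exists_isBlockListing {n : ℕ} {I : Finset ℕ} (hIn : I ⊆ interval (n - 1))
    (hI : IsLacunar I) : ∃ p a j, IsBlockListing n I p a j := by
  let a : ℕ → ℕ := fun m => if m = 0 then 1 else
    if h : m - 1 < I.card then I.orderEmbOfFin rfl ⟨m - 1, h⟩ else n + 1
  have ha : ∀ m (hm : m < I.card), a (m + 1) = I.orderEmbOfFin rfl ⟨m, hm⟩ := by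
    intro m hm
    simp [a, hm]
  have hlast : a (I.card + 1) = n + 1 := by simp [a]
  have hmem : ∀ m (hm : m < I.card), a (m + 1) ∈ I := fun m hm =>
    ha m hm ▸ I.orderEmbOfFin_mem rfl _
  have hmono : ∀ x y (hx : x < I.card) (hy : y < I.card), x < y → a (x + 1) < a (y + 1) := by
    intro x y hx hy hxy
    rw [ha x hx, ha y hy]
    exact (I.orderEmbOfFin rfl).strictMono hxy
  refine ⟨I.card, a, fun m => a m - a (m - 1), hIn, hI, ?_, ?_, rfl, hlast, ?_⟩
  · rintro x ⟨hx, hx'⟩ y ⟨hy, hy'⟩ hxy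
    obtain ⟨x, rfl⟩ := Nat.exists_eq_add_of_le' hx
    obtain ⟨y, rfl⟩ := Nat.exists_eq_add_of_le' hy
    exact hmono x y hx' hy' (by omega)
  · ext z
    constructor
    · intro hz
      have hz' : z ∈ Set.range (I.orderEmbOfFin rfl) := by
        rw [Finset.range_orderEmbOfFin]
        exact hz
      obtain ⟨⟨m, hm⟩, rfl⟩ := hz'
      exact Finset.mem_image.2 ⟨m + 1, Finset.mem_Icc.2 ⟨by omega, hm⟩, ha m hm⟩
    · intro hz
      obtain ⟨m, hm, rfl⟩ := Finset.mem_image.1 hz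
      obtain ⟨hm1, hm2⟩ := Finset.mem_Icc.1 hm
      obtain ⟨m, rfl⟩ := Nat.exists_eq_add_of_le' hm1
      exact hmem m hm2
  · intro m hm
    refine Nat.add_sub_cancel' ?_
    rcases Nat.eq_zero_or_pos m with rfl | h1
    · rcases Nat.eq_zero_or_pos I.card with h0 | h0
      · rw [h0] at hlast
        rw [hlast]
        exact Nat.le_add_left 1 n
      · exact (Finset.mem_Icc.1 (hIn (hmem 0 h0))).1
    · obtain ⟨m, rfl⟩ := Nat.exists_eq_add_of_le' h1
      rcases hm.eq_or_lt with heq | hlt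
      · have hle := (Finset.mem_Icc.1 (hIn (hmem m hm))).2
        rw [heq, hlast, ← heq]
        change a (m + 1) ≤ n + 1
        omega
      · exact (hmono m (m + 1) hm hlt (by omega)).le

theorem isBlockListing_of_int_eq {n : ℕ} {I : Finset ℕ} (hIn : I ⊆ interval (n - 1))
    (hI : IsLacunar I) {p : ℕ} {a j : ℕ → ℕ} (hmono : StrictMonoOn a (Set.Icc 1 p))
    (himage : I = (Finset.Icc 1 p).image a) (h0 : a 0 = 1) (hlast : a (p + 1) = n + 1)
    (hj : ∀ m ∈ Finset.Icc 1 (p + 1), (j m : ℤ) = (a m : ℤ) - (a (m - 1) : ℤ)) :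
    IsBlockListing n I p a j := by
  refine ⟨hIn, hI, hmono, himage, h0, hlast, fun m hm => ?_⟩
  have := hj (m + 1) (Finset.mem_Icc.2 ⟨by omega, by omega⟩)
  rw [Nat.add_sub_cancel] at this
  omega

end CycleShuffle

theorem mainTheorem9 (k : Type*) [CommRing k] (n : ℕ) (Q : ℕ → Finset ℕ)
    (hQ : IsLacunarListing n Q) (i : ℕ) (hi : i ∈ Finset.Icc 1 (Nat.fib (n + 1))) :
    -- (a) `F_i / F_{i-1}` is free of rank `δ_i`
    (Nonempty (Module.Basis (Fin (delta n Q i)) k (Subquotient k n Q i)) ∧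
      (Nontrivial k → Module.finrank k (Subquotient k n Q i) = delta n Q i)) ∧
    -- (b) description by ascents and descents
    delta n Q i =
      Nat.card {w : Sym n //
        (∀ j ∈ Q i, value w j < value w (j + 1)) ∧
        (∀ j ∈ nonShadow n (Q i), value w j > value w (j + 1))} ∧
    -- (c) explicit formula, where `Q_i = {a 1 < a 2 < ⋯ < a p}`, `a 0 = 1`, `a (p + 1) = n + 1`
    (∀ (p : ℕ) (a j : ℕ → ℕ),
      StrictMonoOn a (Set.Icc 1 p) →
      Q i = (Finset.Icc 1 p).image a →
      a 0 = 1 →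
      a (p + 1) = n + 1 →
      (∀ m ∈ Finset.Icc 1 (p + 1), (j m : ℤ) = (a m : ℤ) - (a (m - 1) : ℤ)) →
      ∑ m ∈ Finset.Icc 1 (p + 1), j m = n ∧
      (delta n Q i : ℤ) =
        (Nat.multinomial (Finset.Icc 1 (p + 1)) j : ℤ) *
          ∏ m ∈ Finset.Icc 2 (p + 1), ((j m : ℤ) - 1)) ∧
    -- (d) divisibility
    delta n Q i ∣ n ! := by
  have hQi := hQ.bijOn.mapsTo (Finset.mem_Icc.1 hi)
  have hδ := delta_eq_card_hasPattern hQ hi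
  refine ⟨⟨⟨subquotientBasis k Q hi⟩, fun _ => ?_⟩, hδ, ?_, ?_⟩
  · rw [Module.finrank_eq_card_basis (subquotientBasis k Q hi), Fintype.card_fin]
  · intro p a j hmono himage h0 hlast hj
    have h := isBlockListing_of_int_eq hQi.1 hQi.2 hmono himage h0 hlast hj
    constructor
    · rw [← h.sum_range, Finset.range_eq_Ico, Finset.sum_Ico_add' j]
      rfl
    · rw [hδ, h.card_hasPattern_eq, Nat.cast_mul, Nat.cast_prod]
      congr 1
      change _ = ∏ m ∈ Finset.Ico (0 + 2) (p + 2), _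
      rw [← Finset.prod_Ico_add' (fun m => (j m : ℤ) - 1), Finset.range_eq_Ico]
      refine Finset.prod_congr rfl fun m hm => ?_
      have : 2 ≤ j (m + 2) := h.two_le (by omega) (Finset.mem_Ico.1 hm).2
      exact Nat.cast_pred (by omega)
  · obtain ⟨p, a, j, h⟩ := exists_isBlockListing hQi.1 hQi.2
    exact hδ ▸ h.card_hasPattern_dvd
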